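/- Let $C_d=(0,1)^d\subset\mathbb{R}^d$ be the open unit cube with uniform (Lebesgue) measure $\nu$, and let $(M,g)$ be a smooth $d$-dimensional Riemannian manifold (for instance $M=\mathbb{R}^d$ with the Euclidean metric). A $C^1$ map $h:C_d\to M$ is called an orthogonal coordinate transformation (OCT) if $g\big((dh)_s e_i,(dh)_s e_j\big)=0$ for all $s\in C_d$ and all $i\neq j$, where $e_1,\dots,e_d$ is the standard basis; for $M=\mathbb{R}^d$ this says that $Dh(s)^\top Dh(s)$ is diagonal. Let $T>0$ and let $\Phi:(-T,T)\times C_d\to M$, $\Phi_t=\Phi(t,\cdot)$, be a smooth invariant OCT deformation, i.e. $\Phi$ is twice continuously differentiable in $(t,s)$ and, for every $t\in(-T,T)$, $\Phi_t$ is a diffeomorphism onto its image and an OCT. Let $f:C_d\to M$ be such that $\Phi_0=f$ and $(\Phi_t)_*\nu=f_*\nu$ for all $t\in(-T,T)$, and suppose that there is $\varepsilon>0$ such that $\Phi_t(s)=f(s)$ for all $t\in(-T,T)$ and all $s\in C_d$ with $\operatorname{dist}(s,\partial C_d)<\varepsilon$. Then $\Phi_t(s)=f(s)$ for all $t\in(-T,T)$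 and all $s\in C_d$. (No analyticity in $t$ is assumed.) -/

import Mathlib

open Set MeasureTheory Bundle
open scoped Manifold ContDiff InnerProductSpace

noncomputable section

/-- The open unit cube `(0,1)^d` in Euclidean space. -/
def openCube (d : ℕ) : Set (EuclideanSpace ℝ (Fin d)) :=
  {s | ∀ i, s i ∈ Ioo (0 : ℝ) 1}

/-- The uniform distribution on the open unit cube: Lebesgue measure restricted to it. -/
def cubeMeasure (d : ℕ) : Measure (EuclideanSpace ℝ (Fin d)) :=
  volume.restrict (openCube d)

/-- The map `f` restricts to a diffeomorphism from the open set `U` onto its image, an open subset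
of the `d`-dimensional manifold `M`. -/
def IsDiffeoOntoImage {d : ℕ} {M : Type*} [TopologicalSpace M]
    [ChartedSpace (EuclideanSpace ℝ (Fin d)) M]
    (U : Set (EuclideanSpace ℝ (Fin d))) (f : EuclideanSpace ℝ (Fin d) → M) : Prop :=
  IsOpen U ∧ IsOpen (f '' U) ∧ ContMDiffOn (𝓡 d) (𝓡 d) 1 f U ∧
    ∃ g : M → EuclideanSpace ℝ (Fin d), LeftInvOn g f U ∧ ContMDiffOn (𝓡 d) (𝓡 d) 1 g (f '' U)

/-- Orthogonal coordinate transformations on the open set `U` with values in a `d`-dimensional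
Riemannian manifold `M`: continuously differentiable maps for which the images of the standard
basis vectors under the differential are pairwise orthogonal at every point of `U`. -/
def octMaps {d : ℕ} (M : Type*) [TopologicalSpace M]
    [ChartedSpace (EuclideanSpace ℝ (Fin d)) M] [IsManifold (𝓡 d) ∞ M]
    [RiemannianBundle (fun x : M ↦ TangentSpace (𝓡 d) x)]
    (U : Set (EuclideanSpace ℝ (Fin d))) : Set (EuclideanSpace ℝ (Fin d) → M) :=
  {f | ContMDiffOn (𝓡 d) (𝓡 d) 1 f U ∧
    ∀ s ∈ U, ∀ i j : Fin d, i ≠ j →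
      ⟪mfderiv (𝓡 d) (𝓡 d) f s (EuclideanSpace.single i (1 : ℝ)),
        mfderiv (𝓡 d) (𝓡 d) f s (EuclideanSpace.single j (1 : ℝ))⟫_ℝ = 0}

/-- A smooth (twice continuously differentiable, jointly in `t` and `s`) invariant deformation on
`U` in the function class `F`, with parameter `t ∈ (-T, T)`: every `Φ t` is a diffeomorphism from
`U` onto its image and belongs to `F`. -/
structure IsSmoothInvariantDeformation {d : ℕ} {M : Type*} [TopologicalSpace M]
    [ChartedSpace (EuclideanSpace ℝ (Fin d)) M]
    (F : Set (EuclideanSpace ℝ (Fin d) → M)) (U : Set (EuclideanSpace ℝ (Fin d))) (T : ℝ)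
    (Φ : ℝ → EuclideanSpace ℝ (Fin d) → M) : Prop where
  contMDiffOn : ContMDiffOn 𝓘(ℝ, ℝ × EuclideanSpace ℝ (Fin d)) (𝓡 d) 2
    (fun p : ℝ × EuclideanSpace ℝ (Fin d) ↦ Φ p.1 p.2) (Ioo (-T) T ×ˢ U)
  diffeo : ∀ t ∈ Ioo (-T) T, IsDiffeoOntoImage U (Φ t)
  mem : ∀ t ∈ Ioo (-T) T, Φ t ∈ F

end

/-! Fix a time $t$ and write $H(t',s)=\Phi_t^{-1}(\Phi_{t'}(s))$, so that $H(t,\cdot)$ is the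
identity. Let $X=\partial_{t'}H$ at $t'=t$, a $C^1$ field on the cube that vanishes off a compact
set. With $G_k=|d\Phi_t e_k|^2>0$, differentiating the orthogonality relation gives
$G_k\partial_jX_k+G_j\partial_kX_j=0$ for $j\ne k$ (`fderiv_velocity_antisymm`), and invariance of
the measure gives $\operatorname{div}X=0$ weakly (`integral_fderiv_velocity_eq_zero`).

Choose one direction $i$ and put $\gamma_j=G_j/G_i$. The relations $\partial_iX_i+\sum_{j\ne
i}\partial_jX_j=0$ and $\gamma_j\partial_iX_j+\partial_jX_i=0$ form a symmetric hyperbolic system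
with $x_i$ as time and energy density $\frac12\sum_j\gamma_jX_j^2$. An energy estimate with weight
$e^{-cx_i}$ and compact support force $X=0$ (`vectorField_eq_zero_of_weak_div`). Hence the velocity
vanishes at every time (`velocity_eq_zero`), and each curve $t\mapsto\Phi_t(s)$ is constant. No
analyticity enters, because the argument is run at every $t$ separately. -/

section

open Filter Topology

/-! ### Compact supports and the weighted energy estimate -/

/-- A function that is `C^n` on an open set and vanishes off a compact subset of it is `C^n`. -/
lemma ContDiffOn.contDiff_of_eq_zero_off {E F : Type*} [NormedAddCommGroup E] [NormedSpace ℝ E]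
    [NormedAddCommGroup F] [NormedSpace ℝ F] {n : WithTop ℕ∞} {f : E → F} {U K : Set E}
    (hU : IsOpen U) (hK : IsClosed K) (hKU : K ⊆ U) (hf : ContDiffOn ℝ n f U)
    (h0 : ∀ s ∉ K, f s = 0) : ContDiff ℝ n f := by
  rw [contDiff_iff_contDiffAt]
  intro s
  by_cases hs : s ∈ U
  · exact hf.contDiffAt (hU.mem_nhds hs)
  · have : f =ᶠ[𝓝 s] fun _ ↦ 0 := by
      filter_upwards [hK.isOpen_compl.mem_nhds fun h ↦ hs (hKU h)] with x hx using h0 x hx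
    exact contDiffAt_const.congr_of_eventuallyEq this

/-- The integral of a directional derivative of a compactly supported `C^1` function vanishes. -/
lemma integral_fderiv_apply_eq_zero {E : Type*} [NormedAddCommGroup E] [NormedSpace ℝ E]
    [FiniteDimensional ℝ E] [MeasurableSpace E] [BorelSpace E] {μ : Measure E}
    [μ.IsAddHaarMeasure] {f : E → ℝ} (hf : ContDiff ℝ 1 f) (hc : HasCompactSupport f) (v : E) :
    Integrable (fun s ↦ fderiv ℝ f s v) μ ∧ ∫ s, fderiv ℝ f s v ∂μ = 0 := by
  have h1 : Integrable (fun s ↦ fderiv ℝ f s v) μ := by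
    refine Continuous.integrable_of_hasCompactSupport ?_ ?_
    · exact (hf.continuous_fderiv one_ne_zero).clm_apply continuous_const
    · exact hc.fderiv_apply ℝ v
  refine ⟨h1, ?_⟩
  -- Integration by parts against the constant function 1.
  have := integral_mul_fderiv_eq_neg_fderiv_mul_of_integrable (μ := μ) (𝕜 := ℝ)
    (f := fun _ : E ↦ (1 : ℝ)) (g := f) (v := v) (by simp) (by simpa using h1)
    (by simpa using hf.continuous.integrable_of_hasCompactSupport hc)
    (fun _ _ ↦ by fun_prop) (fun x _ ↦ hf.differentiable one_ne_zero x)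
  simpa using this

lemma EuclideanSpace.eq_sum_smul_single {d : ℕ} (x : EuclideanSpace ℝ (Fin d)) :
    x = ∑ j, x j • EuclideanSpace.single j (1 : ℝ) := by
  ext i
  simp [Finset.sum_apply, Pi.single_apply]

lemma EuclideanSpace.clm_apply_eq_sum {d : ℕ} {F : Type*} [NormedAddCommGroup F] [NormedSpace ℝ F]
    (L : EuclideanSpace ℝ (Fin d) →L[ℝ] F) (x : EuclideanSpace ℝ (Fin d)) :
    L x = ∑ j, x j • L (EuclideanSpace.single j (1 : ℝ)) := by
  conv_lhs => rw [x.eq_sum_smul_single]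
  simp

/-- Uniqueness for a symmetric hyperbolic system: a compactly supported `C^1` vector field that is
weakly divergence free and whose differential is antisymmetric, with respect to positive weights,
between one coordinate direction and all others, vanishes. -/
theorem vectorField_eq_zero_of_weak_div {d : ℕ} {U K : Set (EuclideanSpace ℝ (Fin d))}
    (hU : IsOpen U) (hK : IsCompact K) (hKU : K ⊆ U)
    {X : EuclideanSpace ℝ (Fin d) → EuclideanSpace ℝ (Fin d)} (hX : ContDiff ℝ 1 X)
    (hXK : ∀ s ∉ K, X s = 0) {γ : Fin d → EuclideanSpace ℝ (Fin d) → ℝ}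
    (hγ : ∀ j, ContDiffOn ℝ 1 (γ j) U) (hγpos : ∀ j, ∀ s ∈ U, 0 < γ j s) (i : Fin d)
    (hi : ∀ s ∈ U, γ i s = 1)
    (heq : ∀ s ∈ U, ∀ j, j ≠ i → fderiv ℝ X s (EuclideanSpace.single j 1) i =
      - γ j s * fderiv ℝ X s (EuclideanSpace.single i 1) j)
    (hdiv : ∀ ψ : EuclideanSpace ℝ (Fin d) → ℝ, ContDiff ℝ 1 ψ → (∀ s ∉ K, ψ s = 0) →
      ∫ s, fderiv ℝ ψ s (X s) = 0) (s : EuclideanSpace ℝ (Fin d)) : X s = 0 := by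
  set e : Fin d → EuclideanSpace ℝ (Fin d) := fun j ↦ EuclideanSpace.single j 1 with he
  have hγd : ∀ j, ∀ s ∈ U, DifferentiableAt ℝ (γ j) s := fun j s hs ↦
    ((hγ j).contDiffAt (hU.mem_nhds hs)).differentiableAt one_ne_zero
  -- The decay rate of the weight must beat the logarithmic derivatives of all $\gamma_j$ on $K$,
  -- strictly, so that the quadratic form in `Q` is positive definite there.
  obtain ⟨c, hc⟩ : ∃ c : ℝ, ∀ j, ∀ s ∈ K, fderiv ℝ (γ j) s (e i) < c * γ j s := by
    have : ∀ j, ∃ c : ℝ, ∀ s ∈ K, fderiv ℝ (γ j) s (e i) / γ j s ≤ c := by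
      intro j
      have hcont : ContinuousOn (fun s ↦ fderiv ℝ (γ j) s (e i) / γ j s) K := by
        refine ContinuousOn.div ?_ ((hγ j).continuousOn.mono hKU)
          fun s hs ↦ (hγpos j s (hKU hs)).ne'
        exact (((hγ j).continuousOn_fderiv_of_isOpen hU le_rfl).mono hKU).clm_apply
          continuousOn_const
      obtain ⟨c, hc⟩ := hK.bddAbove_image hcont
      exact ⟨c, fun s hs ↦ hc ⟨s, hs, rfl⟩⟩
    choose c hc using this
    refine ⟨∑ j, |c j| + 1, fun j s hs ↦ ?_⟩
    have h1 := hc j s hs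
    have hp := hγpos j s (hKU hs)
    have h2 : |c j| ≤ ∑ j, |c j| :=
      Finset.single_le_sum (f := fun j ↦ |c j|) (fun _ _ ↦ abs_nonneg _) (Finset.mem_univ j)
    rw [← div_lt_iff₀ hp]
    linarith [le_abs_self (c j)]
  set w : EuclideanSpace ℝ (Fin d) → ℝ := fun s ↦ Real.exp (-(c * s i)) with hw
  have hws : ContDiff ℝ 1 w := by fun_prop
  have hXc : ∀ j, ContDiff ℝ 1 fun s ↦ X s j := fun j ↦ by fun_prop
  -- The energy flux is $\psi X-Ae_i$. Its $i$-th component is the weighted energy density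
  -- $\frac12w\sum_j\gamma_jX_j^2$, and its divergence is $-Q$, where $\operatorname{div}(\psi X)$
  -- is read weakly as $d\psi(X)$.
  set ψ : EuclideanSpace ℝ (Fin d) → ℝ := fun s ↦ w s * X s i with hψ
  set A : EuclideanSpace ℝ (Fin d) → ℝ :=
    fun s ↦ w s * (X s i ^ 2 - (1 / 2) * ∑ j, γ j s * X s j ^ 2) with hA
  set Q : EuclideanSpace ℝ (Fin d) → ℝ :=
    fun s ↦ (1 / 2) * w s * ∑ j, (c * γ j s - fderiv ℝ (γ j) s (e i)) * X s j ^ 2 with hQ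
  have hψ1 : ContDiff ℝ 1 ψ := hws.mul (hXc i)
  have hψ0 : ∀ s ∉ K, ψ s = 0 := fun s hs ↦ by simp [hψ, hXK s hs]
  have hA0 : ∀ s ∉ K, A s = 0 := fun s hs ↦ by simp [hA, hXK s hs]
  have hA1 : ContDiff ℝ 1 A := by
    refine ContDiffOn.contDiff_of_eq_zero_off hU hK.isClosed hKU ?_ hA0
    refine hws.contDiffOn.mul (((hXc i).contDiffOn.pow 2).sub (contDiffOn_const.mul ?_))
    exact ContDiffOn.sum fun j _ ↦ (hγ j).mul ((hXc j).contDiffOn.pow 2)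
  have hAc : HasCompactSupport A := HasCompactSupport.intro hK hA0
  have hwd : ∀ s, HasFDerivAt w
      (w s • (-(c • (EuclideanSpace.proj i : EuclideanSpace ℝ (Fin d) →L[ℝ] ℝ)))) s := by
    intro s
    have h1 : HasFDerivAt (fun s : EuclideanSpace ℝ (Fin d) ↦ -(c * s i))
        (-(c • (EuclideanSpace.proj i : EuclideanSpace ℝ (Fin d) →L[ℝ] ℝ))) s :=
      ((EuclideanSpace.proj (𝕜 := ℝ) i).hasFDerivAt.const_mul c).neg
    exact h1.exp
  have hXd : ∀ s j, HasFDerivAt (fun s ↦ X s j)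
      ((EuclideanSpace.proj j : EuclideanSpace ℝ (Fin d) →L[ℝ] ℝ).comp (fderiv ℝ X s)) s :=
    fun s j ↦ (EuclideanSpace.proj (𝕜 := ℝ) j).hasFDerivAt.comp s
      (hX.differentiable one_ne_zero s).hasFDerivAt
  have hAQ : ∀ s, fderiv ℝ ψ s (X s) - fderiv ℝ A s (e i) = - Q s := by
    intro s
    by_cases hs : s ∈ U
    · have h1 : HasFDerivAt ψ _ s := (hwd s).mul (hXd s i)
      have h2 : HasFDerivAt A _ s := (hwd s).mul (((hXd s i).pow 2).sub
        ((HasFDerivAt.fun_sum (u := Finset.univ) fun j _ ↦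
          ((hγd j s hs).hasFDerivAt.mul ((hXd s j).pow 2))).const_mul (1 / 2)))
      rw [h1.fderiv, h2.fderiv, hQ]
      -- The relation `heq` covers only $j\ne i$. The factor 2 compensates for the term $j=i$ of the
      -- full sum, where $\gamma_i=1$ and the sign is opposite.
      have h3 : fderiv ℝ X s (X s) i = 2 * (X s i * fderiv ℝ X s (e i) i)
          - ∑ j, γ j s * X s j * fderiv ℝ X s (e i) j := by
        rw [EuclideanSpace.clm_apply_eq_sum]
        have : 2 * (X s i * fderiv ℝ X s (e i) i) =
          ∑ j, (if j = i then 2 * (X s i * fderiv ℝ X s (e i) i) else 0) := by simp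
        rw [this, ← Finset.sum_sub_distrib]
        simp only [WithLp.ofLp_sum, Finset.sum_apply, PiLp.smul_apply, smul_eq_mul]
        refine Finset.sum_congr rfl fun j _ ↦ ?_
        by_cases hj : j = i
        · subst hj
          simp [hi s hs]
          ring
        · rw [heq s hs j hj]
          simp [hj]
          ring
      have h4 : (e i) i = 1 := by simp [he]
      have h5 : ∀ (j : Fin d) (x : EuclideanSpace ℝ (Fin d)),
        (EuclideanSpace.proj j : EuclideanSpace ℝ (Fin d) →L[ℝ] ℝ) x = x j := fun _ _ ↦ rfl
      simp only [add_apply, smul_apply, sub_apply, neg_apply, sum_apply,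
        ContinuousLinearMap.comp_apply, h5, smul_eq_mul, h3, h4]
      have h6 : ∑ j, (γ j s * ((2 • X s j ^ (2 - 1)) * fderiv ℝ X s (e i) j) +
          X s j ^ 2 * fderiv ℝ (γ j) s (e i)) = 2 * ∑ j, γ j s * X s j * fderiv ℝ X s (e i) j +
            ∑ j, fderiv ℝ (γ j) s (e i) * X s j ^ 2 := by
        rw [Finset.mul_sum, ← Finset.sum_add_distrib]
        refine Finset.sum_congr rfl fun j _ ↦ ?_
        simp
        ring
      have h7 : ∑ j, (c * γ j s - fderiv ℝ (γ j) s (e i)) * X s j ^ 2 =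
          c * ∑ j, γ j s * X s j ^ 2 - ∑ j, fderiv ℝ (γ j) s (e i) * X s j ^ 2 := by
        rw [Finset.mul_sum, ← Finset.sum_sub_distrib]
        exact Finset.sum_congr rfl fun j _ ↦ by ring
      rw [h6, h7]
      simp
      ring
    · have hsK : s ∉ K := fun h ↦ hs (hKU h)
      have hev : A =ᶠ[𝓝 s] fun _ ↦ 0 := by
        filter_upwards [hK.isClosed.isOpen_compl.mem_nhds hsK] with x hx using hA0 x hx
      rw [hev.fderiv_eq]
      simp [hQ, hXK s hsK]
  have hQ0 : ∀ s, 0 ≤ Q s := by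
    intro s
    by_cases hs : s ∈ K
    · exact mul_nonneg (mul_nonneg (by norm_num) (Real.exp_pos _).le) <|
        Finset.sum_nonneg fun j _ ↦ mul_nonneg (by linarith [hc j s hs]) (sq_nonneg _)
    · simp [hQ, hXK s hs]
  have hQc : Continuous Q := by
    have : Q = fun s ↦ - (fderiv ℝ ψ s (X s) - fderiv ℝ A s (e i)) := by
      ext s; rw [hAQ]; ring
    rw [this]
    exact (((hψ1.continuous_fderiv one_ne_zero).clm_apply hX.continuous).sub
      ((hA1.continuous_fderiv one_ne_zero).clm_apply continuous_const)).neg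
  have hQK : HasCompactSupport Q := HasCompactSupport.intro hK fun s hs ↦ by simp [hQ, hXK s hs]
  have hint : ∫ s, Q s = 0 := by
    obtain ⟨hi1, hi2⟩ := integral_fderiv_apply_eq_zero (μ := volume) hA1 hAc (e i)
    have hi3 := hdiv ψ hψ1 hψ0
    have : ∀ s, Q s = fderiv ℝ A s (e i) - fderiv ℝ ψ s (X s) := fun s ↦ by
      linarith [hAQ s]
    simp_rw [this]
    rw [integral_sub hi1, hi2, hi3, sub_zero]
    refine Continuous.integrable_of_hasCompactSupport
      ((hψ1.continuous_fderiv one_ne_zero).clm_apply hX.continuous)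
      (HasCompactSupport.intro hK fun s hs ↦ by simp [hXK s hs])
  -- A continuous nonnegative function with zero integral vanishes identically.
  have hQz : Q = 0 := by
    rwa [integral_eq_zero_iff_of_nonneg hQ0 (hQc.integrable_of_hasCompactSupport hQK),
      hQc.ae_eq_iff_eq _ continuous_zero] at hint
  by_cases hs : s ∈ K
  · have h1 : Q s = 0 := congrFun hQz s
    have h2 : ∑ j, (c * γ j s - fderiv ℝ (γ j) s (e i)) * X s j ^ 2 = 0 := by
      have := (Real.exp_pos (-(c * s i))).ne'
      simpa [hQ, hw] using h1
    rw [Finset.sum_eq_zero_iff_of_nonneg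
      fun j _ ↦ mul_nonneg (by linarith [hc j s hs]) (sq_nonneg _)] at h2
    ext j
    have h3 := h2 j (Finset.mem_univ j)
    have h4 := hc j s hs
    simpa [(sub_pos.2 h4).ne'] using h3
  · exact hXK s hs

/-! ### Linearised orthogonality -/

/-- Infinitesimal form of the orthogonality relation: if the maps `H (t', ·)` are orthogonal
coordinate transformations for the diagonal metric with entries `G k` and `H (t, ·)` is the
identity, then the velocity field `X` satisfies `G j ∂ᵢ Xⱼ + G i ∂ⱼ Xᵢ = 0`. -/
lemma fderiv_velocity_antisymm {d : ℕ}
    {H : ℝ × EuclideanSpace ℝ (Fin d) → EuclideanSpace ℝ (Fin d)} {t : ℝ}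
    {s₀ : EuclideanSpace ℝ (Fin d)} (hH : ContDiffAt ℝ 2 H (t, s₀))
    {X : EuclideanSpace ℝ (Fin d) → EuclideanSpace ℝ (Fin d)}
    (hX : ∀ᶠ s in 𝓝 s₀, X s = fderiv ℝ H (t, s) (1, 0)) (hid : ∀ᶠ s in 𝓝 s₀, H (t, s) = s)
    {G : Fin d → EuclideanSpace ℝ (Fin d) → ℝ} (hG : ∀ k, DifferentiableAt ℝ (G k) s₀)
    {i j : Fin d} (hij : i ≠ j)
    (horth : ∀ᶠ t' in 𝓝 t, ∑ k, G k (H (t', s₀)) *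
      (fderiv ℝ H (t', s₀) (0, EuclideanSpace.single i 1) k *
        fderiv ℝ H (t', s₀) (0, EuclideanSpace.single j 1) k) = 0) :
    G j s₀ * fderiv ℝ X s₀ (EuclideanSpace.single i 1) j +
      G i s₀ * fderiv ℝ X s₀ (EuclideanSpace.single j 1) i = 0 := by
  have hHd : DifferentiableAt ℝ H (t, s₀) := hH.differentiableAt two_ne_zero
  have hD : DifferentiableAt ℝ (fderiv ℝ H) (t, s₀) :=
    (hH.fderiv_right (m := 1) (by norm_num)).differentiableAt one_ne_zero
  have hsymm : IsSymmSndFDerivAt ℝ H (t, s₀) := hH.isSymmSndFDerivAt (by simp)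
  -- Symmetry of the second derivative: the spatial derivative of the velocity is the time
  -- derivative of the spatial derivative.
  have hXd : ∀ v, fderiv ℝ X s₀ v = fderiv ℝ (fderiv ℝ H) (t, s₀) (1, 0) (0, v) := by
    intro v
    have h1 : HasFDerivAt (fun s : EuclideanSpace ℝ (Fin d) ↦ (t, s))
        (ContinuousLinearMap.inr ℝ ℝ (EuclideanSpace ℝ (Fin d))) s₀ := hasFDerivAt_prodMk_right t s₀
    have h2 : HasFDerivAt (fun s ↦ fderiv ℝ H (t, s) (1, 0)) _ s₀ :=
      (hD.hasFDerivAt.comp s₀ h1).clm_apply (hasFDerivAt_const (1, 0) s₀)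
    rw [EventuallyEq.fderiv_eq hX, h2.fderiv]
    simpa using hsymm.eq (0, v) (1, 0)
  have hline : HasDerivAt (fun t' : ℝ ↦ (t', s₀)) ((1 : ℝ), (0 : EuclideanSpace ℝ (Fin d))) t :=
    (hasDerivAt_id t).prodMk (hasDerivAt_const t s₀)
  have hp : ∀ v : EuclideanSpace ℝ (Fin d), ∀ k, HasDerivAt
      (fun t' ↦ fderiv ℝ H (t', s₀) (0, v) k) (fderiv ℝ X s₀ v k) t := by
    intro v k
    have h2 : HasDerivAt (fun t' ↦ fderiv ℝ H (t', s₀))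
        (fderiv ℝ (fderiv ℝ H) (t, s₀) (1, 0)) t := hD.hasFDerivAt.comp_hasDerivAt t hline
    have h3 : HasDerivAt (fun t' ↦ fderiv ℝ H (t', s₀) (0, v)) (fderiv ℝ X s₀ v) t := by
      rw [hXd]
      simpa using h2.clm_apply (hasDerivAt_const t ((0 : ℝ), v))
    exact (EuclideanSpace.proj k : EuclideanSpace ℝ (Fin d) →L[ℝ] ℝ).hasFDerivAt.comp_hasDerivAt t h3
  have hHid : H (t, s₀) = s₀ := hid.self_of_nhds
  have hp0 : ∀ v : EuclideanSpace ℝ (Fin d), fderiv ℝ H (t, s₀) (0, v) = v := by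
    intro v
    have h1 : HasFDerivAt (fun s ↦ H (t, s)) _ s₀ :=
      HasFDerivAt.comp s₀ hHd.hasFDerivAt (hasFDerivAt_prodMk_right t s₀)
    have h2 := h1.fderiv
    rw [EventuallyEq.fderiv_eq (f₁ := fun s ↦ H (t, s)) (f := id) hid, fderiv_id] at h2
    simpa using (congrArg (fun L ↦ L v) h2).symm
  have hGd : ∀ k, DifferentiableAt ℝ (fun t' ↦ G k (H (t', s₀))) t := by
    intro k
    have h1 : DifferentiableAt ℝ (fun t' ↦ H (t', s₀)) t :=
      (hHd.hasFDerivAt.comp_hasDerivAt t hline).differentiableAt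
    refine DifferentiableAt.comp t ?_ h1
    simpa only [hHid] using hG k
  have hsum : HasDerivAt (fun t' ↦ ∑ k, G k (H (t', s₀)) *
      (fderiv ℝ H (t', s₀) (0, EuclideanSpace.single i 1) k *
        fderiv ℝ H (t', s₀) (0, EuclideanSpace.single j 1) k)) _ t :=
    HasDerivAt.fun_sum (u := Finset.univ) fun k _ ↦ (hGd k).hasDerivAt.mul
      ((hp (EuclideanSpace.single i 1) k).mul (hp (EuclideanSpace.single j 1) k))
  have hzero := hsum.deriv
  rw [EventuallyEq.deriv_eq (f := fun _ ↦ (0 : ℝ)) horth, deriv_const] at hzero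
  simp only [hp0, hHid] at hzero
  -- These products multiply the derivatives of $G_k$ along the motion. They vanish since $i\ne j$,
  -- so no zeroth-order term in $X$ survives.
  have hδ : ∀ k, (EuclideanSpace.single i (1 : ℝ) : EuclideanSpace ℝ (Fin d)) k *
      (EuclideanSpace.single j (1 : ℝ) : EuclideanSpace ℝ (Fin d)) k = 0 := by
    intro k
    by_cases hk : k = i
    · subst hk; simp [hij]
    · simp [hk]
  simp only [hδ, mul_zero, zero_add, mul_add, Finset.sum_add_distrib] at hzero
  simp at hzero
  linarith

/-! ### Regularity of inverses and of the pulled-back metric -/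

/-- A differentiable local left inverse of a `C^n` map between finite-dimensional spaces of the same
dimension is `C^n`. -/
lemma ContDiffAt.of_eventually_leftInverse {E : Type*} [NormedAddCommGroup E] [NormedSpace ℝ E]
    [FiniteDimensional ℝ E] {n : WithTop ℕ∞} (hn : n ≠ 0) {a b : E → E} {x : E}
    (ha : ContDiffAt ℝ n a x) (hb : DifferentiableAt ℝ b (a x)) (hba : ∀ᶠ y in 𝓝 x, b (a y) = y) :
    ContDiffAt ℝ n b (a x) := by
  have : CompleteSpace E := FiniteDimensional.complete ℝ E
  have had : DifferentiableAt ℝ a x := ha.differentiableAt hn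
  -- The chain rule makes the differential of `a` injective, hence invertible by equality of
  -- dimensions, and the inverse function theorem applies.
  have hcomp : (fderiv ℝ b (a x)).comp (fderiv ℝ a x) = ContinuousLinearMap.id ℝ E := by
    rw [← fderiv_comp x hb had, EventuallyEq.fderiv_eq (f₁ := b ∘ a) (f := id) hba,
      fderiv_id]
  have hinj : Function.Injective (fderiv ℝ a x) :=
    Function.LeftInverse.injective (g := fderiv ℝ b (a x)) fun v ↦
      congrArg (fun L : E →L[ℝ] E ↦ L v) hcomp
  let A : E ≃L[ℝ] E :=
    (LinearEquiv.ofInjectiveEndo (fderiv ℝ a x : E →ₗ[ℝ] E) hinj).toContinuousLinearEquiv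
  have hA : HasFDerivAt a (A : E →L[ℝ] E) x := by
    have : (A : E →L[ℝ] E) = fderiv ℝ a x := by ext v; rfl
    rw [this]
    exact had.hasFDerivAt
  refine (ha.to_localInverse hA hn).congr_of_eventuallyEq ?_
  have hs := ha.hasStrictFDerivAt' hA hn
  have h1 : Tendsto (hs.localInverse a A x) (𝓝 (a x)) (𝓝 x) := hs.localInverse_tendsto
  -- Near `a x`, the map `b` is the local inverse: apply $b\circ a=\mathrm{id}$ at the point that
  -- the local inverse returns.
  filter_upwards [hs.eventually_right_inverse, h1.eventually hba] with y hy1 hy2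
  rw [hy1] at hy2
  exact hy2

section Manifold

variable {d : ℕ} {M : Type*} [TopologicalSpace M] [ChartedSpace (EuclideanSpace ℝ (Fin d)) M]

/-- A differentiable local left inverse of a `C^n` map into a manifold of the same dimension
is `C^n`. -/
lemma ContMDiffAt.of_eventually_leftInverse {n : WithTop ℕ∞} [IsManifold (𝓡 d) n M] (hn : n ≠ 0)
    {f : EuclideanSpace ℝ (Fin d) → M} {g : M → EuclideanSpace ℝ (Fin d)}
    {s : EuclideanSpace ℝ (Fin d)} (hf : ContMDiffAt (𝓡 d) (𝓡 d) n f s)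
    (hg : MDifferentiableAt (𝓡 d) (𝓡 d) g (f s)) (hgf : ∀ᶠ y in 𝓝 s, g (f y) = y) :
    ContMDiffAt (𝓡 d) (𝓡 d) n g (f s) := by
  have : IsManifold (𝓡 d) 1 M := IsManifold.of_le (n := n) (ENat.one_le_iff_ne_zero_withTop.2 hn)
  set κ := extChartAt (𝓡 d) (f s) with hκ
  have hκs : ContMDiffAt (𝓡 d) (𝓡 d) n κ (f s) := contMDiffAt_extChartAt
  have ha : ContDiffAt ℝ n (fun y ↦ κ (f y)) s := (hκs.comp s hf).contDiffAt
  have hinv : ∀ᶠ x in 𝓝 (f s), κ.symm (κ x) = x := by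
    filter_upwards [extChartAt_source_mem_nhds (I := 𝓡 d) (f s)] with x hx using κ.left_inv hx
  have hsymm : ContMDiffAt (𝓡 d) (𝓡 d) n κ.symm (κ (f s)) :=
    (contMDiffOn_extChartAt_symm (f s)).contMDiffAt (extChartAt_target_mem_nhds (f s))
  have hb : DifferentiableAt ℝ (fun y ↦ g (κ.symm y)) (κ (f s)) := by
    have : MDifferentiableAt (𝓡 d) (𝓡 d) (g ∘ κ.symm) (κ (f s)) := by
      refine MDifferentiableAt.comp _ ?_ (hsymm.mdifferentiableAt hn)
      rwa [hinv.self_of_nhds]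
    exact this.differentiableAt
  have hba : ∀ᶠ y in 𝓝 s, g (κ.symm (κ (f y))) = y := by
    filter_upwards [hgf, hf.continuousAt.eventually hinv] with y h1 h2
    rw [h2, h1]
  have hbn : ContDiffAt ℝ n (fun y ↦ g (κ.symm y)) (κ (f s)) :=
    ContDiffAt.of_eventually_leftInverse hn ha hb hba
  refine (hbn.contMDiffAt.comp (f s) hκs).congr_of_eventuallyEq ?_
  filter_upwards [hinv] with x hx
  simp [hx]

variable [IsManifold (𝓡 d) ∞ M] [RiemannianBundle (fun x : M ↦ TangentSpace (𝓡 d) x)]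

/-- The inner products of the images of two fixed vectors under the differential of a `C^2` map
into a Riemannian manifold form a `C^1` function. -/
lemma ContMDiffOn.contDiffOn_inner_mfderiv
    [IsContMDiffRiemannianBundle (𝓡 d) ∞ (EuclideanSpace ℝ (Fin d))
      (fun x : M ↦ TangentSpace (𝓡 d) x)]
    {f : EuclideanSpace ℝ (Fin d) → M} {U : Set (EuclideanSpace ℝ (Fin d))} (hU : IsOpen U)
    (hf : ContMDiffOn (𝓡 d) (𝓡 d) 2 f U) (v w : EuclideanSpace ℝ (Fin d)) :
    ContDiffOn ℝ 1 (fun s ↦ ⟪mfderiv (𝓡 d) (𝓡 d) f s v, mfderiv (𝓡 d) (𝓡 d) f s w⟫_ℝ) U := by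
  have : IsManifold (𝓡 d) 1 M := IsManifold.of_le (n := ∞) (by norm_num)
  have : IsContMDiffRiemannianBundle (𝓡 d) 1 (EuclideanSpace ℝ (Fin d))
      (fun x : M ↦ TangentSpace (𝓡 d) x) := IsContMDiffRiemannianBundle.of_le (n := ∞) (by norm_num)
  have key : ∀ v : EuclideanSpace ℝ (Fin d), ContMDiffOn (𝓡 d) (𝓡 d).tangent 1
      (fun s ↦ (⟨f s, mfderiv (𝓡 d) (𝓡 d) f s v⟩ : TangentBundle (𝓡 d) M)) U := by
    intro v
    have h1 := hf.contMDiffOn_tangentMapWithin (m := 1) (by norm_num) hU.uniqueMDiffOn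
    have h2 : ContMDiffOn (𝓡 d) (𝓡 d).tangent 1
        (fun s ↦ (⟨s, v⟩ : TangentBundle (𝓡 d) (EuclideanSpace ℝ (Fin d)))) U :=
      contMDiffOn_vectorSpace_iff_contDiffOn.2 contDiffOn_const
    refine (h1.comp h2 fun s hs ↦ hs).congr fun s hs ↦ ?_
    simp only [Function.comp_apply, tangentMapWithin]
    rw [mfderivWithin_of_isOpen hU hs]
  exact ((key v).inner_bundle (key w)).contDiffOn

end Manifold

/-! ### Coordinate changes between members of the deformation -/

section Deformation

variable {d : ℕ} {M : Type*} [TopologicalSpace M] [ChartedSpace (EuclideanSpace ℝ (Fin d)) M]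
  {J : Set ℝ} {U : Set (EuclideanSpace ℝ (Fin d))} {Φ : ℝ → EuclideanSpace ℝ (Fin d) → M} {t : ℝ}
  {g : M → EuclideanSpace ℝ (Fin d)}

lemma ContMDiffOn.contMDiffOn_slice {n : WithTop ℕ∞}
    (hΦ : ContMDiffOn 𝓘(ℝ, ℝ × EuclideanSpace ℝ (Fin d)) (𝓡 d) n
      (fun p : ℝ × EuclideanSpace ℝ (Fin d) ↦ Φ p.1 p.2) (J ×ˢ U)) (ht : t ∈ J) :
    ContMDiffOn (𝓡 d) (𝓡 d) n (Φ t) U := by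
  have h1 : ContMDiff (𝓡 d) 𝓘(ℝ, ℝ × EuclideanSpace ℝ (Fin d)) n
      (fun s : EuclideanSpace ℝ (Fin d) ↦ (t, s)) :=
    (contDiff_prodMk_right t).contMDiff
  exact hΦ.comp h1.contMDiffOn fun s hs ↦ ⟨ht, hs⟩

variable [IsManifold (𝓡 d) ∞ M] in
/-- The inverse of a `C^2` diffeomorphism onto an open image is `C^2`. -/
lemma IsDiffeoOntoImage.exists_leftInverse {h : EuclideanSpace ℝ (Fin d) → M}
    (hh : IsDiffeoOntoImage U h) (h2 : ContMDiffOn (𝓡 d) (𝓡 d) 2 h U) :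
    ∃ g : M → EuclideanSpace ℝ (Fin d), LeftInvOn g h U ∧
      ∀ x ∈ h '' U, ContMDiffAt (𝓡 d) (𝓡 d) 2 g x := by
  obtain ⟨hU, hV, -, g, hg, hg1⟩ := hh
  refine ⟨g, hg, ?_⟩
  rintro _ ⟨s, hs, rfl⟩
  have : IsManifold (𝓡 d) 2 M := IsManifold.of_le (n := ∞) (by norm_cast)
  refine ContMDiffAt.of_eventually_leftInverse two_ne_zero (h2.contMDiffAt (hU.mem_nhds hs))
    ((hg1.contMDiffAt (hV.mem_nhds ⟨s, hs, rfl⟩)).mdifferentiableAt one_ne_zero) ?_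
  filter_upwards [hU.mem_nhds hs] with y hy using hg hy

lemma contDiffAt_leftInverse_comp (hJ : IsOpen J) (hU : IsOpen U)
    (hΦ : ContMDiffOn 𝓘(ℝ, ℝ × EuclideanSpace ℝ (Fin d)) (𝓡 d) 2
      (fun p : ℝ × EuclideanSpace ℝ (Fin d) ↦ Φ p.1 p.2) (J ×ˢ U))
    {p : ℝ × EuclideanSpace ℝ (Fin d)} (hp : p ∈ J ×ˢ U)
    (hg : ContMDiffAt (𝓡 d) (𝓡 d) 2 g (Φ p.1 p.2)) :
    ContDiffAt ℝ 2 (fun p : ℝ × EuclideanSpace ℝ (Fin d) ↦ g (Φ p.1 p.2)) p :=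
  (ContMDiffAt.comp p hg (hΦ.contMDiffAt ((hJ.prod hU).mem_nhds hp))).contDiffAt

/-- On such a neighbourhood $\Phi_t\circ g$ fixes $\Phi_{t'}(s)$, so $\Phi_{t'}$ factors through
$\Phi_t$ there, even if $\Phi_{t'}(U)$ is not contained in $\Phi_t(U)$. -/
lemma eventually_mem_image (hJ : IsOpen J) (hU : IsOpen U) (hV : IsOpen (Φ t '' U))
    (hΦ : ContMDiffOn 𝓘(ℝ, ℝ × EuclideanSpace ℝ (Fin d)) (𝓡 d) 2
      (fun p : ℝ × EuclideanSpace ℝ (Fin d) ↦ Φ p.1 p.2) (J ×ˢ U))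
    {p : ℝ × EuclideanSpace ℝ (Fin d)} (hp : p ∈ J ×ˢ U) (hpV : Φ p.1 p.2 ∈ Φ t '' U) :
    ∀ᶠ q in 𝓝 p, q ∈ J ×ˢ U ∧ Φ q.1 q.2 ∈ Φ t '' U :=
  ((hJ.prod hU).eventually_mem hp).and
    ((hΦ.continuousOn.continuousAt ((hJ.prod hU).mem_nhds hp)).eventually (hV.eventually_mem hpV))

/-- By the chain rule $dg\circ dh=\mathrm{id}$. This is the source of the positivity of the metric
coefficients. -/
lemma mfderiv_single_ne_zero {h : EuclideanSpace ℝ (Fin d) → M} {s : EuclideanSpace ℝ (Fin d)}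
    (hh : MDifferentiableAt (𝓡 d) (𝓡 d) h s) (hg : MDifferentiableAt (𝓡 d) (𝓡 d) g (h s))
    (hgh : ∀ᶠ y in 𝓝 s, g (h y) = y) (k : Fin d) :
    mfderiv (𝓡 d) (𝓡 d) h s (EuclideanSpace.single k (1 : ℝ)) ≠ 0 := by
  intro h0
  have h1 := mfderiv_comp s hg hh
  rw [Filter.EventuallyEq.mfderiv_eq (f₁ := g ∘ h) (f := id) hgh, mfderiv_id] at h1
  have h2 := congrArg (fun L : EuclideanSpace ℝ (Fin d) →L[ℝ] EuclideanSpace ℝ (Fin d) ↦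
    L (EuclideanSpace.single k (1 : ℝ)) k) h1
  have h3 : mfderiv (𝓡 d) (𝓡 d) g (h s) (mfderiv (𝓡 d) (𝓡 d) h s (EuclideanSpace.single k (1 : ℝ)))
      = 0 := (congrArg (mfderiv (𝓡 d) (𝓡 d) g (h s)) h0).trans (map_zero _)
  have h4 : (EuclideanSpace.single k (1 : ℝ) : EuclideanSpace ℝ (Fin d)) k = 0 :=
    h2.trans (congrArg (fun x : EuclideanSpace ℝ (Fin d) ↦ x k) h3)
  simp at h4

variable [RiemannianBundle (fun x : M ↦ TangentSpace (𝓡 d) x)]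

/-- The base points `f₁ s` and `f₂ s` are only propositionally equal, so the two inner products live
on different tangent spaces. All these spaces unfold to the model space, where the vectors can be
compared. -/
lemma inner_mfderiv_congr {f₁ f₂ : EuclideanSpace ℝ (Fin d) → M} {s : EuclideanSpace ℝ (Fin d)}
    (h : f₁ =ᶠ[𝓝 s] f₂) (v w : EuclideanSpace ℝ (Fin d)) :
    ⟪mfderiv (𝓡 d) (𝓡 d) f₁ s v, mfderiv (𝓡 d) (𝓡 d) f₁ s w⟫_ℝ =
      ⟪mfderiv (𝓡 d) (𝓡 d) f₂ s v, mfderiv (𝓡 d) (𝓡 d) f₂ s w⟫_ℝ := by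
  have key : ∀ {x y : M} (_ : x = y) {a a' b b' : EuclideanSpace ℝ (Fin d)} (_ : a = a')
      (_ : b = b'), @inner ℝ (TangentSpace (𝓡 d) x) _ a b =
        @inner ℝ (TangentSpace (𝓡 d) y) _ a' b' := by
    rintro x _ rfl a _ b _ rfl rfl
    rfl
  have h1 := h.mfderiv_eq (I := 𝓡 d) (I' := 𝓡 d)
  exact key h.self_of_nhds
    (congrArg (fun L : EuclideanSpace ℝ (Fin d) →L[ℝ] EuclideanSpace ℝ (Fin d) ↦ L v) h1)
    (congrArg (fun L : EuclideanSpace ℝ (Fin d) →L[ℝ] EuclideanSpace ℝ (Fin d) ↦ L w) h1)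

variable [IsManifold (𝓡 d) ∞ M]

/-- For an orthogonal coordinate transformation, the pulled back metric is diagonal. -/
lemma inner_mfderiv_eq_sum {h : EuclideanSpace ℝ (Fin d) → M} (hh : h ∈ octMaps M U)
    {s : EuclideanSpace ℝ (Fin d)} (hs : s ∈ U) (v w : EuclideanSpace ℝ (Fin d)) :
    ⟪mfderiv (𝓡 d) (𝓡 d) h s v, mfderiv (𝓡 d) (𝓡 d) h s w⟫_ℝ =
      ∑ k, ⟪mfderiv (𝓡 d) (𝓡 d) h s (EuclideanSpace.single k (1 : ℝ)),
        mfderiv (𝓡 d) (𝓡 d) h s (EuclideanSpace.single k (1 : ℝ))⟫_ℝ * (v k * w k) := by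
  have key : ∀ v : EuclideanSpace ℝ (Fin d), mfderiv (𝓡 d) (𝓡 d) h s v =
      ∑ k, v k • mfderiv (𝓡 d) (𝓡 d) h s (EuclideanSpace.single k (1 : ℝ)) := by
    intro v
    conv_lhs => rw [EuclideanSpace.eq_sum_smul_single v]
    exact (map_sum _ _ _).trans (Finset.sum_congr rfl fun k _ ↦ map_smul _ _ _)
  rw [key v, key w, sum_inner]
  refine Finset.sum_congr rfl fun k _ ↦ ?_
  rw [inner_sum, Finset.sum_eq_single k]
  · rw [real_inner_smul_left, real_inner_smul_right]
    ring
  · intro j _ hj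
    rw [real_inner_smul_left, real_inner_smul_right, hh.2 s hs k j hj.symm]
    simp
  · simp

/-- The coordinate change between two members of a deformation by orthogonal coordinate
transformations is orthogonal for the pulled back diagonal metric. -/
lemma sum_inner_mfderiv_mul_eq_zero (hJ : IsOpen J) (hU : IsOpen U) (hV : IsOpen (Φ t '' U))
    (hΦ : ContMDiffOn 𝓘(ℝ, ℝ × EuclideanSpace ℝ (Fin d)) (𝓡 d) 2
      (fun p : ℝ × EuclideanSpace ℝ (Fin d) ↦ Φ p.1 p.2) (J ×ˢ U))
    (hmem : ∀ t ∈ J, Φ t ∈ octMaps M U) (ht : t ∈ J) (hgl : LeftInvOn g (Φ t) U)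
    (hg : ∀ x ∈ Φ t '' U, ContMDiffAt (𝓡 d) (𝓡 d) 2 g x) {t' : ℝ} {s : EuclideanSpace ℝ (Fin d)}
    (ht' : t' ∈ J) (hs : s ∈ U) (hst : Φ t' s ∈ Φ t '' U) {i j : Fin d} (hij : i ≠ j) :
    ∑ k, ⟪mfderiv (𝓡 d) (𝓡 d) (Φ t) (g (Φ t' s)) (EuclideanSpace.single k (1 : ℝ)),
        mfderiv (𝓡 d) (𝓡 d) (Φ t) (g (Φ t' s)) (EuclideanSpace.single k (1 : ℝ))⟫_ℝ *
      (fderiv ℝ (fun p : ℝ × EuclideanSpace ℝ (Fin d) ↦ g (Φ p.1 p.2)) (t', s)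
          (0, EuclideanSpace.single i 1) k *
        fderiv ℝ (fun p : ℝ × EuclideanSpace ℝ (Fin d) ↦ g (Φ p.1 p.2)) (t', s)
          (0, EuclideanSpace.single j 1) k) = 0 := by
  have hgU : g (Φ t' s) ∈ U := by
    obtain ⟨y, hy, hyx⟩ := hst
    rw [← hyx, hgl hy]
    exact hy
  have hp : ((t', s) : ℝ × EuclideanSpace ℝ (Fin d)) ∈ J ×ˢ U := ⟨ht', hs⟩
  set H : ℝ × EuclideanSpace ℝ (Fin d) → EuclideanSpace ℝ (Fin d) := fun p ↦ g (Φ p.1 p.2) with hH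
  have hHd : DifferentiableAt ℝ H (t', s) :=
    (contDiffAt_leftInverse_comp hJ hU hΦ hp (hg _ hst)).differentiableAt two_ne_zero
  have hslice : HasFDerivAt (fun y ↦ H (t', y))
      ((fderiv ℝ H (t', s)).comp (ContinuousLinearMap.inr ℝ ℝ (EuclideanSpace ℝ (Fin d)))) s :=
    HasFDerivAt.comp s hHd.hasFDerivAt (hasFDerivAt_prodMk_right t' s)
  -- Through this factorisation, orthogonality of $\Phi_{t'}$ for $g$ becomes orthogonality of
  -- $H(t',\cdot)$ for the diagonal metric pulled back by $\Phi_t$.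
  have hev : Φ t' =ᶠ[𝓝 s] Φ t ∘ fun y ↦ H (t', y) := by
    have h1 : Tendsto (fun y : EuclideanSpace ℝ (Fin d) ↦ (t', y)) (𝓝 s) (𝓝 (t', s)) :=
      (Continuous.prodMk_right t').tendsto s
    filter_upwards [h1.eventually (eventually_mem_image hJ hU hV hΦ hp hst)] with y hy
    obtain ⟨z, hz, hzx⟩ := hy.2
    simp only [hH, Function.comp_apply]
    rw [← hzx, hgl hz]
  have hmd : MDifferentiableAt (𝓡 d) (𝓡 d) (Φ t) (g (Φ t' s)) :=
    ((hΦ.contMDiffOn_slice ht).contMDiffAt (hU.mem_nhds hgU)).mdifferentiableAt two_ne_zero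
  have hcomp : ∀ v, mfderiv (𝓡 d) (𝓡 d) (Φ t ∘ fun y ↦ H (t', y)) s v =
      mfderiv (𝓡 d) (𝓡 d) (Φ t) (g (Φ t' s)) (fderiv ℝ H (t', s) (0, v)) := by
    intro v
    rw [mfderiv_comp s hmd hslice.differentiableAt.mdifferentiableAt, mfderiv_eq_fderiv,
      hslice.fderiv]
    rfl
  have horth := (hmem t' ht').2 s hs i j hij
  rw [← inner_mfderiv_eq_sum (hmem t ht) hgU]
  exact (congrArg₂ (@inner ℝ (TangentSpace (𝓡 d) (Φ t (g (Φ t' s)))) _) (hcomp _)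
    (hcomp _)).symm.trans ((inner_mfderiv_congr hev _ _).symm.trans horth)

end Deformation

/-! ### Measure preservation and the weak divergence -/

section Divergence

variable {d : ℕ} {M : Type*} [TopologicalSpace M] [ChartedSpace (EuclideanSpace ℝ (Fin d)) M]
  {J : Set ℝ} {U K : Set (EuclideanSpace ℝ (Fin d))} {Φ : ℝ → EuclideanSpace ℝ (Fin d) → M} {t : ℝ}
  {g : M → EuclideanSpace ℝ (Fin d)}

/-- Pushing forward a `C^1` function supported in a compact subset of `U` along a diffeomorphism
onto an open image. -/
lemma contMDiff_extend_leftInverse [T2Space M] {h : EuclideanSpace ℝ (Fin d) → M}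
    (hV : IsOpen (h '' U)) (hh : ContinuousOn h U)
    (hK : IsCompact K) (hKU : K ⊆ U) (hgl : LeftInvOn g h U)
    (hg : ∀ x ∈ h '' U, ContMDiffAt (𝓡 d) (𝓡 d) 2 g x) {ψ : EuclideanSpace ℝ (Fin d) → ℝ}
    (hψ : ContDiff ℝ 1 ψ) (hψK : ∀ s ∉ K, ψ s = 0) :
    ContMDiff (𝓡 d) 𝓘(ℝ, ℝ) 1 ((h '' U).indicator fun x ↦ ψ (g x)) := by
  intro x
  by_cases hx : x ∈ h '' U
  · have h1 : ContMDiffAt (𝓡 d) 𝓘(ℝ, ℝ) 1 (fun x ↦ ψ (g x)) x :=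
      ContMDiffAt.comp x hψ.contMDiff.contMDiffAt ((hg x hx).of_le one_le_two)
    refine h1.congr_of_eventuallyEq ?_
    filter_upwards [hV.mem_nhds hx] with y hy using indicator_of_mem hy _
  · have hKc : IsClosed (h '' K) := (hK.image_of_continuousOn (hh.mono hKU)).isClosed
    have h1 : x ∉ h '' K := fun hxK ↦ hx (image_mono hKU hxK)
    refine (contMDiffAt_const (c := (0 : ℝ))).congr_of_eventuallyEq ?_
    filter_upwards [hKc.isOpen_compl.mem_nhds h1] with y hy
    by_cases hyV : y ∈ h '' U
    · rw [indicator_of_mem hyV]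
      obtain ⟨s, hs, rfl⟩ := hyV
      rw [hgl hs]
      exact hψK s fun hsK ↦ hy ⟨s, hsK, rfl⟩
    · exact indicator_of_notMem hyV _

/-- The velocity field of a measure preserving deformation is weakly divergence free. -/
theorem integral_fderiv_velocity_eq_zero [T2Space M] [MeasurableSpace M] [BorelSpace M]
    (hJ : IsOpen J) (hU : IsOpen U) (hUfin : volume U ≠ ⊤) (hV : IsOpen (Φ t '' U))
    (hK : IsCompact K) (hKU : K ⊆ U)
    (hΦ : ContMDiffOn 𝓘(ℝ, ℝ × EuclideanSpace ℝ (Fin d)) (𝓡 d) 2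
      (fun p : ℝ × EuclideanSpace ℝ (Fin d) ↦ Φ p.1 p.2) (J ×ˢ U))
    (ht : t ∈ J) (hgl : LeftInvOn g (Φ t) U)
    (hg : ∀ x ∈ Φ t '' U, ContMDiffAt (𝓡 d) (𝓡 d) 2 g x)
    (hmap : ∀ t' ∈ J, (volume.restrict U).map (Φ t') = (volume.restrict U).map (Φ t))
    (hfix : ∀ t' ∈ J, ∀ s ∈ U, s ∉ K → Φ t' s = Φ t s)
    {X : EuclideanSpace ℝ (Fin d) → EuclideanSpace ℝ (Fin d)} (hXc : Continuous X)
    (hX : ∀ s ∈ U, X s =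
      fderiv ℝ (fun p : ℝ × EuclideanSpace ℝ (Fin d) ↦ g (Φ p.1 p.2)) (t, s) (1, 0))
    (hX0 : ∀ s ∉ U, X s = 0) {ψ : EuclideanSpace ℝ (Fin d) → ℝ}
    (hψ : ContDiff ℝ 1 ψ) (hψK : ∀ s ∉ K, ψ s = 0) :
    ∫ s, fderiv ℝ ψ s (X s) = 0 := by
  have : IsFiniteMeasure (volume.restrict U) := ⟨by simpa using hUfin.lt_top⟩
  -- The test function is transported to all of $M$, so that $\int_U\varphi\circ\Phi_{t'}$ depends
  -- only on the pushed-forward measure and is constant in $t'$. Its derivative at $t$ is the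
  -- integral to be computed.
  set φ : M → ℝ := (Φ t '' U).indicator fun x ↦ ψ (g x) with hφ
  have hφ1 : ContMDiff (𝓡 d) 𝓘(ℝ, ℝ) 1 φ := contMDiff_extend_leftInverse hV
    (hΦ.contMDiffOn_slice ht).continuousOn hK hKU hgl hg hψ hψK
  set F : ℝ × EuclideanSpace ℝ (Fin d) → ℝ := fun p ↦ φ (Φ p.1 p.2) with hF
  have hF1 : ContDiffOn ℝ 1 F (J ×ˢ U) :=
    (hφ1.comp_contMDiffOn (hΦ.of_le one_le_two)).contDiffOn
  have hFs : ∀ t' ∈ J, ContinuousOn (fun s ↦ F (t', s)) U := fun t' ht' ↦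
    hF1.continuousOn.comp (Continuous.prodMk_right t').continuousOn fun s hs ↦ ⟨ht', hs⟩
  have hconst : ∀ t' ∈ J, ∫ s in U, F (t', s) = ∫ s in U, F (t, s) := by
    have key : ∀ t' ∈ J, ∫ s in U, F (t', s) = ∫ x, φ x ∂((volume.restrict U).map (Φ t')) := by
      intro t' ht'
      rw [integral_map]
      · exact (hΦ.contMDiffOn_slice ht').continuousOn.aemeasurable hU.measurableSet
      · exact hφ1.continuous.aestronglyMeasurable
    intro t' ht'
    rw [key t' ht', key t ht, hmap t' ht']
  obtain ⟨δ, hδ, hδJ⟩ := Metric.nhds_basis_closedBall.mem_iff.1 (hJ.mem_nhds ht)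
  obtain ⟨C, hC⟩ := ((isCompact_closedBall t δ).prod hK).exists_bound_of_continuousOn
    ((hF1.continuousOn_fderiv_of_isOpen (hJ.prod hU) le_rfl).mono (prod_mono hδJ hKU))
  have hFd : ∀ t' ∈ J, ∀ s ∈ U, HasDerivAt (fun t' ↦ F (t', s)) (fderiv ℝ F (t', s) (1, 0)) t' := by
    intro t' ht' s hs
    have h1 : DifferentiableAt ℝ F (t', s) := (hF1.contDiffAt
      ((hJ.prod hU).mem_nhds ⟨ht', hs⟩)).differentiableAt one_ne_zero
    exact h1.hasFDerivAt.comp_hasDerivAt t' ((hasDerivAt_id t').prodMk (hasDerivAt_const t' s))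
  -- Domination for differentiating under the integral: a compactness bound on the derivative for
  -- $s\in K$, and no dependence on $t'$ for $s\notin K$.
  have hlip : ∀ s ∈ U, LipschitzOnWith (Real.nnabs C) (fun t' ↦ F (t', s))
      (Metric.closedBall t δ) := by
    intro s hs
    by_cases hsK : s ∈ K
    · refine (convex_closedBall t δ).lipschitzOnWith_of_nnnorm_hasDerivWithin_le
        (fun t' ht' ↦ (hFd t' (hδJ ht') s hs).hasDerivWithinAt) fun t' ht' ↦ ?_
      rw [← NNReal.coe_le_coe, coe_nnnorm, Real.coe_nnabs]
      calc ‖fderiv ℝ F (t', s) (1, 0)‖ ≤ ‖fderiv ℝ F (t', s)‖ *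
            ‖((1 : ℝ), (0 : EuclideanSpace ℝ (Fin d)))‖ := ContinuousLinearMap.le_opNorm _ _
        _ = ‖fderiv ℝ F (t', s)‖ := by simp [Prod.norm_def]
        _ ≤ C := hC (t', s) ⟨ht', hsK⟩
        _ ≤ |C| := le_abs_self C
    · intro t₁ h₁ t₂ h₂
      simp [hF, hfix t₁ (hδJ h₁) s hs hsK, hfix t₂ (hδJ h₂) s hs hsK]
  have hderiv : ∀ s ∈ U, HasDerivAt (fun t' ↦ F (t', s)) (fderiv ℝ ψ s (X s)) t := by
    intro s hs
    have hp : ((t, s) : ℝ × EuclideanSpace ℝ (Fin d)) ∈ J ×ˢ U := ⟨ht, hs⟩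
    have hpV : Φ t s ∈ Φ t '' U := ⟨s, hs, rfl⟩
    have hline : HasDerivAt (fun t' : ℝ ↦ (t', s)) ((1 : ℝ), (0 : EuclideanSpace ℝ (Fin d))) t :=
      (hasDerivAt_id t).prodMk (hasDerivAt_const t s)
    have hH : HasDerivAt (fun t' ↦ g (Φ t' s)) (X s) t := by
      rw [hX s hs]
      exact ((contDiffAt_leftInverse_comp hJ hU hΦ hp (hg _ hpV)).differentiableAt
        two_ne_zero).hasFDerivAt.comp_hasDerivAt t hline
    have hψd : HasFDerivAt ψ (fderiv ℝ ψ s) (g (Φ t s)) := by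
      rw [hgl hs]
      exact (hψ.differentiable one_ne_zero s).hasFDerivAt
    refine (hψd.comp_hasDerivAt t hH).congr_of_eventuallyEq ?_
    filter_upwards [hline.continuousAt.eventually (eventually_mem_image hJ hU hV hΦ hp hpV)]
      with t' ht'
    exact indicator_of_mem ht'.2 _
  have hFint : Integrable (fun s ↦ F (t, s)) (volume.restrict U) := by
    have h1 : Integrable ψ (volume.restrict U) :=
      (hψ.continuous.integrable_of_hasCompactSupport (HasCompactSupport.intro hK hψK)).restrict
    refine h1.congr ?_
    filter_upwards [ae_restrict_mem hU.measurableSet] with s hs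
    simp only [hF, hφ]
    rw [indicator_of_mem (mem_image_of_mem (Φ t) hs), hgl hs]
  have hmain := (hasDerivAt_integral_of_dominated_loc_of_lip (μ := volume.restrict U)
    (F := fun t' s ↦ F (t', s)) (F' := fun s ↦ fderiv ℝ ψ s (X s)) (bound := fun _ ↦ C)
    (Metric.closedBall_mem_nhds t hδ)
    (by filter_upwards [hJ.mem_nhds ht] with t' ht'
        exact (hFs t' ht').aestronglyMeasurable hU.measurableSet) hFint
    ((hψ.continuous_fderiv one_ne_zero).clm_apply hXc).aestronglyMeasurable
    (by filter_upwards [ae_restrict_mem hU.measurableSet] with s hs using hlip s hs)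
    (integrable_const C)
    (by filter_upwards [ae_restrict_mem hU.measurableSet] with s hs using hderiv s hs)).2
  have hzero : HasDerivAt (fun t' ↦ ∫ s in U, F (t', s)) 0 t := by
    refine (hasDerivAt_const t (∫ s in U, F (t, s))).congr_of_eventuallyEq ?_
    filter_upwards [hJ.mem_nhds ht] with t' ht' using hconst t' ht'
  rw [← setIntegral_eq_integral_of_forall_compl_eq_zero (s := U)
    fun s hs ↦ by rw [hX0 s hs, map_zero]]
  exact hmain.unique hzero

end Divergence

lemma isBounded_openCube (d : ℕ) : Bornology.IsBounded (openCube d) := by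
  have h1 : IsCompact (WithLp.toLp 2 '' (Icc 0 1 : Set (Fin d → ℝ))) :=
    isCompact_Icc.image (PiLp.continuous_toLp 2 _)
  refine h1.isBounded.subset fun s hs ↦ ⟨s.ofLp, ⟨fun i ↦ (hs i).1.le, fun i ↦ (hs i).2.le⟩, rfl⟩

/-! ### Vanishing of the velocity -/

section Deformation

variable {d : ℕ} {M : Type*} [TopologicalSpace M] [ChartedSpace (EuclideanSpace ℝ (Fin d)) M]
  {J : Set ℝ} {U K : Set (EuclideanSpace ℝ (Fin d))} {Φ : ℝ → EuclideanSpace ℝ (Fin d) → M} {t : ℝ}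
  {g : M → EuclideanSpace ℝ (Fin d)}

lemma contDiffOn_velocity (hJ : IsOpen J) (hU : IsOpen U)
    (hΦ : ContMDiffOn 𝓘(ℝ, ℝ × EuclideanSpace ℝ (Fin d)) (𝓡 d) 2
      (fun p : ℝ × EuclideanSpace ℝ (Fin d) ↦ Φ p.1 p.2) (J ×ˢ U)) (ht : t ∈ J)
    (hg : ∀ x ∈ Φ t '' U, ContMDiffAt (𝓡 d) (𝓡 d) 2 g x) :
    ContDiffOn ℝ 1 (fun s ↦ fderiv ℝ
      (fun p : ℝ × EuclideanSpace ℝ (Fin d) ↦ g (Φ p.1 p.2)) (t, s) (1, 0)) U := by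
  intro s hs
  have h1 : ContDiffAt ℝ 1 (fderiv ℝ fun p : ℝ × EuclideanSpace ℝ (Fin d) ↦ g (Φ p.1 p.2)) (t, s) :=
    (contDiffAt_leftInverse_comp hJ hU hΦ ⟨ht, hs⟩ (hg _ ⟨s, hs, rfl⟩)).fderiv_right (by norm_num)
  exact ((h1.comp s (contDiff_prodMk_right t).contDiffAt).clm_apply
    contDiffAt_const).contDiffWithinAt

/-- The velocity field of a measure preserving deformation by orthogonal coordinate transformations
that is stationary off a compact set vanishes. -/
theorem velocity_eq_zero [T2Space M] [MeasurableSpace M] [BorelSpace M] [IsManifold (𝓡 d) ∞ M]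
    [RiemannianBundle (fun x : M ↦ TangentSpace (𝓡 d) x)]
    [IsContMDiffRiemannianBundle (𝓡 d) ∞ (EuclideanSpace ℝ (Fin d))
      (fun x : M ↦ TangentSpace (𝓡 d) x)]
    (hJ : IsOpen J) (hU : IsOpen U) (hUfin : volume U ≠ ⊤) (hV : IsOpen (Φ t '' U))
    (hK : IsCompact K) (hKU : K ⊆ U)
    (hΦ : ContMDiffOn 𝓘(ℝ, ℝ × EuclideanSpace ℝ (Fin d)) (𝓡 d) 2
      (fun p : ℝ × EuclideanSpace ℝ (Fin d) ↦ Φ p.1 p.2) (J ×ˢ U))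
    (hmem : ∀ t ∈ J, Φ t ∈ octMaps M U)
    (ht : t ∈ J) (hgl : LeftInvOn g (Φ t) U)
    (hg : ∀ x ∈ Φ t '' U, ContMDiffAt (𝓡 d) (𝓡 d) 2 g x)
    (hmap : ∀ t' ∈ J, (volume.restrict U).map (Φ t') = (volume.restrict U).map (Φ t))
    (hfix : ∀ t' ∈ J, ∀ s ∈ U, s ∉ K → Φ t' s = Φ t s)
    {s : EuclideanSpace ℝ (Fin d)} (hs : s ∈ U) :
    fderiv ℝ (fun p : ℝ × EuclideanSpace ℝ (Fin d) ↦ g (Φ p.1 p.2)) (t, s) (1, 0) = 0 := by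
  rcases isEmpty_or_nonempty (Fin d) with hd | ⟨⟨i⟩⟩
  -- In dimension 0 there is no direction to serve as time, but the velocity is trivially zero.
  · exact Subsingleton.elim _ _
  set H : ℝ × EuclideanSpace ℝ (Fin d) → EuclideanSpace ℝ (Fin d) := fun p ↦ g (Φ p.1 p.2) with hH
  set X : EuclideanSpace ℝ (Fin d) → EuclideanSpace ℝ (Fin d) :=
    U.indicator fun s ↦ fderiv ℝ H (t, s) (1, 0) with hXdef
  have hX : ∀ s ∈ U, X s = fderiv ℝ H (t, s) (1, 0) := fun s hs ↦ indicator_of_mem hs _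
  have hX0 : ∀ s ∉ U, X s = 0 := fun s hs ↦ indicator_of_notMem hs _
  have hH2 : ∀ s ∈ U, ContDiffAt ℝ 2 H (t, s) := fun s hs ↦
    contDiffAt_leftInverse_comp hJ hU hΦ ⟨ht, hs⟩ (hg _ ⟨s, hs, rfl⟩)
  have hline : ∀ s : EuclideanSpace ℝ (Fin d),
      HasDerivAt (fun t' : ℝ ↦ (t', s)) ((1 : ℝ), (0 : EuclideanSpace ℝ (Fin d))) t :=
    fun s ↦ (hasDerivAt_id t).prodMk (hasDerivAt_const t s)
  have hXK : ∀ s ∉ K, X s = 0 := by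
    intro s hsK
    by_cases hs : s ∈ U
    · rw [hX s hs]
      have hHd : HasFDerivAt H (fderiv ℝ H (t, s)) (t, s) :=
        ((hH2 s hs).differentiableAt two_ne_zero).hasFDerivAt
      have h1 : HasDerivAt (fun t' ↦ H (t', s)) (fderiv ℝ H (t, s) (1, 0)) t :=
        HasFDerivAt.comp_hasDerivAt (l := H) t hHd (hline s)
      refine h1.unique ((hasDerivAt_const t (H (t, s))).congr_of_eventuallyEq ?_)
      filter_upwards [hJ.mem_nhds ht] with t' ht'
      simp only [hH]
      rw [hfix t' ht' s hs hsK]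
    · exact hX0 s hs
  have hX1 : ContDiff ℝ 1 X := ContDiffOn.contDiff_of_eq_zero_off hU hK.isClosed hKU
    ((contDiffOn_velocity hJ hU hΦ ht hg).congr hX) hXK
  set G : Fin d → EuclideanSpace ℝ (Fin d) → ℝ := fun k s ↦
    ⟪mfderiv (𝓡 d) (𝓡 d) (Φ t) s (EuclideanSpace.single k (1 : ℝ)),
      mfderiv (𝓡 d) (𝓡 d) (Φ t) s (EuclideanSpace.single k (1 : ℝ))⟫_ℝ with hG
  have hΦt : ContMDiffOn (𝓡 d) (𝓡 d) 2 (Φ t) U := hΦ.contMDiffOn_slice ht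
  have hG1 : ∀ k, ContDiffOn ℝ 1 (G k) U := fun k ↦ hΦt.contDiffOn_inner_mfderiv hU _ _
  have hGpos : ∀ k, ∀ s ∈ U, 0 < G k s := by
    intro k s hs
    refine real_inner_self_pos.2 (mfderiv_single_ne_zero (g := g)
      ((hΦt.contMDiffAt (hU.mem_nhds hs)).mdifferentiableAt two_ne_zero)
      ((hg _ ⟨s, hs, rfl⟩).mdifferentiableAt two_ne_zero) ?_ k)
    filter_upwards [hU.mem_nhds hs] with y hy using hgl hy
  have hanti : ∀ s ∈ U, ∀ j k, j ≠ k → G k s * fderiv ℝ X s (EuclideanSpace.single j 1) k +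
      G j s * fderiv ℝ X s (EuclideanSpace.single k 1) j = 0 := by
    intro s hs j k hjk
    refine fderiv_velocity_antisymm (hH2 s hs) ?_ ?_ (fun k ↦ ((hG1 k).contDiffAt
      (hU.mem_nhds hs)).differentiableAt one_ne_zero) hjk ?_
    · filter_upwards [hU.mem_nhds hs] with y hy using hX y hy
    · filter_upwards [hU.mem_nhds hs] with y hy using hgl hy
    · filter_upwards [(hline s).continuousAt.eventually
        (eventually_mem_image hJ hU hV hΦ ⟨ht, hs⟩ (mem_image_of_mem _ hs))] with t' ht'
      exact sum_inner_mfderiv_mul_eq_zero hJ hU hV hΦ hmem ht hgl hg ht'.1.1 hs ht'.2 hjk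
  rw [← hX s hs]
  -- Dividing by $G_i$ normalises the weight of the time direction to 1, matching its coefficient in
  -- the divergence equation.
  refine vectorField_eq_zero_of_weak_div hU hK hKU hX1 hXK (γ := fun j s ↦ G j s / G i s)
    (fun j ↦ (hG1 j).div (hG1 i) fun s hs ↦ (hGpos i s hs).ne')
    (fun j s hs ↦ div_pos (hGpos j s hs) (hGpos i s hs)) i
    (fun s hs ↦ div_self (hGpos i s hs).ne') ?_ ?_ s
  · intro s hs j hj
    have h1 := hanti s hs j i hj
    have h2 := (hGpos i s hs).ne'
    field_simp
    linarith
  · exact fun ψ hψ hψK ↦ integral_fderiv_velocity_eq_zero hJ hU hUfin hV hK hKU hΦ ht hgl hg hmap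
      hfix hX1.continuous hX hX0 hψ hψK

/-- A point of a deformation whose velocity vanishes has vanishing derivative in time. -/
lemma hasMFDerivAt_zero_of_velocity_eq_zero [IsManifold (𝓡 d) ∞ M]
    (hJ : IsOpen J) (hU : IsOpen U) (hV : IsOpen (Φ t '' U))
    (hΦ : ContMDiffOn 𝓘(ℝ, ℝ × EuclideanSpace ℝ (Fin d)) (𝓡 d) 2
      (fun p : ℝ × EuclideanSpace ℝ (Fin d) ↦ Φ p.1 p.2) (J ×ˢ U))
    (ht : t ∈ J) (hgl : LeftInvOn g (Φ t) U)
    (hg : ∀ x ∈ Φ t '' U, ContMDiffAt (𝓡 d) (𝓡 d) 2 g x)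
    {s : EuclideanSpace ℝ (Fin d)} (hs : s ∈ U)
    (h0 : fderiv ℝ (fun p : ℝ × EuclideanSpace ℝ (Fin d) ↦ g (Φ p.1 p.2)) (t, s) (1, 0) = 0) :
    HasMFDerivAt 𝓘(ℝ, ℝ) (𝓡 d) (fun t' ↦ Φ t' s) t 0 := by
  have hline : HasDerivAt (fun t' : ℝ ↦ (t', s)) ((1 : ℝ), (0 : EuclideanSpace ℝ (Fin d))) t :=
    (hasDerivAt_id t).prodMk (hasDerivAt_const t s)
  have h1 : HasDerivAt (fun t' ↦ g (Φ t' s)) 0 t := by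
    rw [← h0]
    exact ((contDiffAt_leftInverse_comp hJ hU hΦ ⟨ht, hs⟩ (hg _ ⟨s, hs, rfl⟩)).differentiableAt
      two_ne_zero).hasFDerivAt.comp_hasDerivAt t hline
  have hgs : g (Φ t s) = s := hgl hs
  have h2 : MDifferentiableAt (𝓡 d) (𝓡 d) (Φ t) (g (Φ t s)) := by
    rw [hgs]
    exact ((hΦ.contMDiffOn_slice ht).contMDiffAt (hU.mem_nhds hs)).mdifferentiableAt two_ne_zero
  have h3 : HasMFDerivAt 𝓘(ℝ, ℝ) (𝓡 d) (fun t' ↦ g (Φ t' s)) t 0 := by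
    have := h1.hasFDerivAt.hasMFDerivAt
    rwa [ContinuousLinearMap.toSpanSingleton_zero] at this
  -- Near $t$ the curve $t'\mapsto\Phi_{t'}(s)$ equals $\Phi_t\circ H(\cdot,s)$, and the inner map
  -- has zero derivative.
  have h4 := HasMFDerivAt.comp t h2.hasMFDerivAt h3
  rw [ContinuousLinearMap.comp_zero] at h4
  refine h4.congr_of_eventuallyEq ?_
  filter_upwards [hline.continuousAt.eventually
    (eventually_mem_image hJ hU hV hΦ ⟨ht, hs⟩ (mem_image_of_mem _ hs))] with t' ht'
  obtain ⟨z, hz, hzx⟩ := ht'.2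
  simp only [Function.comp_apply]
  rw [← hzx, hgl hz]

end Deformation

end

/-! ### Conclusion -/

theorem mainTheorem10 {d : ℕ} {M : Type*} [TopologicalSpace M] [T2Space M]
    [SecondCountableTopology M] [MeasurableSpace M] [BorelSpace M]
    [ChartedSpace (EuclideanSpace ℝ (Fin d)) M] [IsManifold (𝓡 d) ∞ M]
    [RiemannianBundle (fun x : M ↦ TangentSpace (𝓡 d) x)]
    [IsContMDiffRiemannianBundle (𝓡 d) ∞ (EuclideanSpace ℝ (Fin d))
      (fun x : M ↦ TangentSpace (𝓡 d) x)]
    (T : ℝ) (hT : 0 < T)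
    (f : EuclideanSpace ℝ (Fin d) → M) (Φ : ℝ → EuclideanSpace ℝ (Fin d) → M)
    (hΦ : IsSmoothInvariantDeformation (octMaps M (openCube d)) (openCube d) T Φ)
    (hzero : ∀ s ∈ openCube d, Φ 0 s = f s)
    (hmap : ∀ t ∈ Ioo (-T) T, (cubeMeasure d).map (Φ t) = (cubeMeasure d).map f)
    (hbdry : ∃ ε > (0 : ℝ), ∀ t ∈ Ioo (-T) T, ∀ s ∈ openCube d,
      Metric.infDist s (frontier (openCube d)) < ε → Φ t s = f s) :
    ∀ t ∈ Ioo (-T) T, ∀ s ∈ openCube d, Φ t s = f s := by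
  obtain ⟨ε, hε, hbdry⟩ := hbdry
  have h0 : (0 : ℝ) ∈ Ioo (-T) T := ⟨by linarith, hT⟩
  have hU : IsOpen (openCube d) := (hΦ.diffeo 0 h0).1
  -- The closure makes $K$ compact, and the distance condition removes the frontier, so $K$ still
  -- lies inside the open cube.
  set K : Set (EuclideanSpace ℝ (Fin d)) :=
    closure (openCube d) ∩ {s | ε ≤ Metric.infDist s (frontier (openCube d))} with hKdef
  have hK : IsCompact K := (isBounded_openCube d).isCompact_closure.inter_right
    (isClosed_le continuous_const (Metric.continuous_infDist_pt _))
  have hKU : K ⊆ openCube d := by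
    rintro s ⟨hs, hsε⟩
    by_contra hsU
    have : s ∈ frontier (openCube d) := by
      rw [hU.frontier_eq]
      exact ⟨hs, hsU⟩
    have h1 := Metric.infDist_zero_of_mem this
    simp only [mem_ofPred_eq, h1] at hsε
    linarith
  have hfix : ∀ t ∈ Ioo (-T) T, ∀ s ∈ openCube d, s ∉ K → Φ t s = f s := by
    intro t ht s hs hsK
    refine hbdry t ht s hs (lt_of_not_ge fun h ↦ hsK ⟨subset_closure hs, h⟩)
  have hder : ∀ s ∈ openCube d, ∀ t ∈ Ioo (-T) T,
      HasMFDerivAt 𝓘(ℝ, ℝ) (𝓡 d) (fun t' ↦ Φ t' s) t 0 := by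
    intro s hs t ht
    have hV := (hΦ.diffeo t ht).2.1
    obtain ⟨g, hgl, hg⟩ := (hΦ.diffeo t ht).exists_leftInverse (hΦ.contMDiffOn.contMDiffOn_slice ht)
    refine hasMFDerivAt_zero_of_velocity_eq_zero isOpen_Ioo hU hV hΦ.contMDiffOn ht hgl hg hs ?_
    exact velocity_eq_zero isOpen_Ioo hU (isBounded_openCube d).measure_lt_top.ne hV hK hKU
      hΦ.contMDiffOn hΦ.mem ht hgl hg (fun t' ht' ↦ (hmap t' ht').trans (hmap t ht).symm)
      (fun t' ht' s hs hsK ↦ (hfix t' ht' s hs hsK).trans (hfix t ht s hs hsK).symm) hs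
  intro t ht s hs
  have : IsManifold (𝓡 d) 1 M := IsManifold.of_le (n := ∞) (by norm_num)
  rw [← hzero s hs]
  -- Both the curve and the constant curve are integral curves of the zero vector field through the
  -- same point at time 0, so uniqueness identifies them.
  refine isMIntegralCurveOn_Ioo_eqOn_of_contMDiff_boundaryless (I := 𝓡 d)
    (γ := fun t' ↦ Φ t' s) (γ' := fun _ ↦ Φ 0 s) (v := fun _ ↦ 0) h0
    (contMDiff_zeroSection ℝ _) ?_ ?_ rfl ht
  · intro t' ht'
    have h1 : ((1 : ℝ →L[ℝ] ℝ).smulRight (0 : TangentSpace (𝓡 d) (Φ t' s))) = 0 :=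
      ContinuousLinearMap.smulRight_zero _
    exact h1 ▸ (hder s hs t' ht').hasMFDerivWithinAt
  · intro t' ht'
    have h1 : ((1 : ℝ →L[ℝ] ℝ).smulRight (0 : TangentSpace (𝓡 d) (Φ 0 s))) = 0 :=
      ContinuousLinearMap.smulRight_zero _
    exact h1 ▸ (hasMFDerivAt_const (Φ 0 s) t').hasMFDerivWithinAt
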